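/- A super-ring is a $\mathbb{Z}/2$-graded ring $A=A_0\oplus A_1$ with unity that is super-commutative: elements of $A_0$ commute with all homogeneous elements, and $s^2=0$ for every $s\in A_1$. Super-ideals are homogeneous ideals; $A$ is Noetherian if its super-ideals satisfy the ascending chain condition; a super-ideal $\mathfrak p$ is prime if $A/\mathfrak p$ is an integral domain, and then $A_{\mathfrak p}=(A_0\setminus\mathfrak p_0)^{-1}A$, where $\mathfrak p_0=\mathfrak p\cap A_0$. The Krull super-dimension of $A$ is $\mathrm{Ksdim}(A)=r\mid s$, where $r=\mathrm{Ksdim}_0(A)$ is the Krull dimension of $A_0$ and $s=\mathrm{Ksdim}_1(A)$ is the largest length of a system of odd parameters, that is, of a sequence $y_1,\dots,y_s\in A_1$ such that $$\mathrm{Kdim}\bigl(A_0/\mathrm{Ann}_{A_0}(y_1\cdots y_s)\bigr)=\mathrm{Kdim}(A_0).$$ For the zero ring, $\mathrm{Ksdim}(0)=-\infty\mid 0$ by convention. Super-dimension vectors are ordered lexicographically: $a\mid b<c\mid d$ if $a<c$, or $a=c$ and $b<d$; the supremum of the empty set is the least vector $-\infty\mid 0$. **Theorem.** Let $A$ be a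 Noetherian super-ring with $\mathrm{Ksdim}_0(A)<\infty$. Let $I$ be a super-ideal of $A$ and let $\widehat A=\varprojlim_n A/I^n$ be its $I$-adic completion (a super-ring with the grading induced from $A$). Then $$\mathrm{Ksdim}(\widehat A)=\sup_{\mathfrak p\supseteq I}\mathrm{Ksdim}(A_{\mathfrak p}),$$ where $\mathfrak p$ runs over the prime super-ideals of $A$ that contain $I$, and the supremum is taken in the lexicographic order. -/

import Mathlib

/-- A super-commutative super-ring: a ring `A` (with unity) with a `ZMod 2`-grading
`A = 𝒜 0 ⊕ 𝒜 1`, in which even elements commute with all homogeneous elements and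
odd elements have square zero. -/
class SuperRing {A : Type*} [Ring A] (𝒜 : ZMod 2 → AddSubgroup A) extends GradedRing 𝒜 where
  even_comm : ∀ r ∈ 𝒜 0, ∀ i : ZMod 2, ∀ s ∈ 𝒜 i, r * s = s * r
  odd_sq : ∀ s ∈ 𝒜 1, s * s = 0

namespace SuperRing

/-- A `ZMod 2`-indexed family of additive subgroups, closed under multiplication, with
`B = ℬ 0 + ℬ 1` and `ℬ 0 ∩ ℬ 1 = 0`, is a grading. -/
noncomputable abbrev gradedRingOfSum {B : Type*} [Ring B] (ℬ : ZMod 2 → AddSubgroup B)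
    (hm : SetLike.GradedMonoid ℬ)
    (hsum : ∀ x : B, ∃ a ∈ ℬ 0, ∃ b ∈ ℬ 1, a + b = x)
    (hdisj : ∀ x : B, x ∈ ℬ 0 → x ∈ ℬ 1 → x = 0) : GradedRing ℬ :=
  have key : DirectSum.IsInternal ℬ := by
    have hcoe : ∀ x : DirectSum (ZMod 2) (fun i => ℬ i),
        DirectSum.coeAddMonoidHom ℬ x = (x 0 : B) + (x 1 : B) := by
      intro x
      induction x using DirectSum.induction_on with
      | zero => simp
      | of i x =>
        rw [DirectSum.coeAddMonoidHom_of]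
        fin_cases i
        · have h : (DirectSum.of (fun i => ℬ i) (0 : ZMod 2) x) 1 = 0 :=
            DirectSum.of_eq_of_ne _ _ _ (by decide)
          exact (by
            rw [h, DirectSum.of_eq_same]; simp :
            (x : B) = ((DirectSum.of (fun i => ℬ i) (0 : ZMod 2) x) 0 : B)
              + ((DirectSum.of (fun i => ℬ i) (0 : ZMod 2) x) 1 : B))
        · have h : (DirectSum.of (fun i => ℬ i) (1 : ZMod 2) x) 0 = 0 :=
            DirectSum.of_eq_of_ne _ _ _ (by decide)
          exact (by
            rw [h, DirectSum.of_eq_same]; simp :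
            (x : B) = ((DirectSum.of (fun i => ℬ i) (1 : ZMod 2) x) 0 : B)
              + ((DirectSum.of (fun i => ℬ i) (1 : ZMod 2) x) 1 : B))
      | add x y hx hy =>
        rw [map_add, hx, hy]
        simp only [DirectSum.add_apply, AddSubgroup.coe_add]
        abel
    refine ⟨?_, ?_⟩
    · rw [injective_iff_map_eq_zero]
      intro x hx
      rw [hcoe] at hx
      have h1 : ((x 0 : ℬ 0) : B) = -((x 1 : ℬ 1) : B) := eq_neg_of_add_eq_zero_left hx
      have h0 : ((x 0 : ℬ 0) : B) = 0 :=
        hdisj _ (x 0).2 (by rw [h1]; exact neg_mem (x 1).2)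
      have h1' : ((x 1 : ℬ 1) : B) = 0 := by simpa [h0] using hx
      refine DFinsupp.ext fun i => ?_
      fin_cases i
      · exact Subtype.ext h0
      · exact Subtype.ext h1'
    · intro x
      obtain ⟨a, ha, b, hb, rfl⟩ := hsum x
      refine ⟨DirectSum.of (fun i => ℬ i) 0 ⟨a, ha⟩ + DirectSum.of (fun i => ℬ i) 1 ⟨b, hb⟩, ?_⟩
      rw [map_add, DirectSum.coeAddMonoidHom_of, DirectSum.coeAddMonoidHom_of]
  { hm, key.chooseDecomposition with }

variable {A : Type*} [Ring A] (𝒜 : ZMod 2 → AddSubgroup A) [SuperRing 𝒜]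

theorem proj_add_proj (x : A) : GradedRing.proj 𝒜 0 x + GradedRing.proj 𝒜 1 x = x := by
  induction x using DirectSum.Decomposition.inductionOn 𝒜 with
  | zero => simp
  | @homogeneous i m =>
    rw [GradedRing.proj_apply, GradedRing.proj_apply]
    have hi : i = 0 ∨ i = 1 := (by decide : ∀ k : ZMod 2, k = 0 ∨ k = 1) i
    rcases hi with rfl | rfl
    · rw [DirectSum.decompose_of_mem_same 𝒜 m.2,
        DirectSum.decompose_of_mem_ne 𝒜 m.2 (by decide), add_zero]
    · rw [DirectSum.decompose_of_mem_same 𝒜 m.2,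
        DirectSum.decompose_of_mem_ne 𝒜 m.2 (by decide), zero_add]
  | add m m' h h' =>
    rw [map_add, map_add, add_add_add_comm, h, h']

theorem exists_add (x : A) : ∃ a ∈ 𝒜 0, ∃ b ∈ 𝒜 1, a + b = x := by
  refine ⟨GradedRing.proj 𝒜 0 x, SetLike.coe_mem _, GradedRing.proj 𝒜 1 x, SetLike.coe_mem _,
    proj_add_proj 𝒜 x⟩

theorem eq_zero_of_mem_mem {x : A} (h0 : x ∈ 𝒜 0) (h1 : x ∈ 𝒜 1) : x = 0 := by
  have a := DirectSum.decompose_of_mem_same 𝒜 h0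
  rw [DirectSum.decompose_of_mem_ne 𝒜 h1 (by decide)] at a
  exact a.symm

theorem even_comm' {r : A} (hr : r ∈ 𝒜 0) (x : A) : r * x = x * r := by
  obtain ⟨a, ha, b, hb, rfl⟩ := exists_add 𝒜 x
  rw [mul_add, add_mul, even_comm r hr 0 a ha, even_comm r hr 1 b hb]

theorem odd_anticomm {s t : A} (hs : s ∈ 𝒜 1) (ht : t ∈ 𝒜 1) : s * t = -(t * s) := by
  have h := odd_sq (𝒜 := 𝒜) _ (add_mem hs ht)
  rw [add_mul, mul_add, mul_add, odd_sq (𝒜 := 𝒜) s hs, odd_sq (𝒜 := 𝒜) t ht] at h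
  rw [zero_add, add_zero] at h
  exact eq_neg_of_add_eq_zero_left h

/-- The even part `A₀` of a super-ring, as a subring of `A`. -/
def evenPart : Subring A where
  carrier := 𝒜 0
  mul_mem' {a b} ha hb := by
    have h := SetLike.mul_mem_graded (A := 𝒜) ha hb
    rwa [add_zero] at h
  one_mem' := SetLike.one_mem_graded 𝒜
  add_mem' := add_mem
  zero_mem' := zero_mem _
  neg_mem' := neg_mem

instance : CommRing (evenPart 𝒜) :=
  { (inferInstance : Ring (evenPart 𝒜)) with
    mul_comm := fun a b => Subtype.ext (even_comm' 𝒜 a.2 b) }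

instance : Algebra (evenPart 𝒜) A where
  algebraMap := (evenPart 𝒜).subtype
  commutes' r x := even_comm' 𝒜 r.2 x
  smul_def' _ _ := rfl

/-! ### Super-ideals -/

/-- Every (left) super-ideal, i.e. homogeneous left ideal, is two-sided. -/
instance isTwoSided (I : HomogeneousIdeal 𝒜) : I.toIdeal.IsTwoSided where
  mul_mem_of_left {a} b ha := by
    have h0 : GradedRing.proj 𝒜 0 a ∈ I.toIdeal := I.isHomogeneous 0 ha
    have h1 : GradedRing.proj 𝒜 1 a ∈ I.toIdeal := I.isHomogeneous 1 ha
    have m0 : GradedRing.proj 𝒜 0 a ∈ 𝒜 0 := SetLike.coe_mem _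
    have m1 : GradedRing.proj 𝒜 1 a ∈ 𝒜 1 := SetLike.coe_mem _
    have hs : GradedRing.proj 𝒜 0 a + GradedRing.proj 𝒜 1 a = a :=
      proj_add_proj 𝒜 a
    rw [← hs, add_mul]
    refine add_mem ?_ ?_
    · rw [even_comm' 𝒜 m0]
      exact I.toIdeal.mul_mem_left _ h0
    · obtain ⟨c, hc, d, hd, rfl⟩ := exists_add 𝒜 b
      rw [mul_add, ← even_comm' 𝒜 hc, odd_anticomm 𝒜 m1 hd]
      exact add_mem (I.toIdeal.mul_mem_left _ h1) (neg_mem (I.toIdeal.mul_mem_left _ h1))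

/-- A super-ring is Noetherian if its super-ideals satisfy the ascending chain condition. -/
def IsNoetherian : Prop := WellFoundedGT (HomogeneousIdeal 𝒜)

variable {𝒜} in
/-- A super-ideal `𝔭` is prime if `A ⧸ 𝔭` is an integral domain. (Commutativity of the quotient
is automatic, see `IsPrime.quotient_mul_comm`.) -/
def IsPrime (p : HomogeneousIdeal 𝒜) : Prop := IsDomain (A ⧸ p.toIdeal)

variable {𝒜} in
theorem IsPrime.quotient_mul_comm {p : HomogeneousIdeal 𝒜} (hp : IsPrime p)
    (x y : A ⧸ p.toIdeal) : x * y = y * x := by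
  have : IsDomain (A ⧸ p.toIdeal) := hp
  obtain ⟨x, rfl⟩ := Ideal.Quotient.mk_surjective x
  obtain ⟨y, rfl⟩ := Ideal.Quotient.mk_surjective y
  obtain ⟨a, ha, b, hb, rfl⟩ := exists_add 𝒜 x
  have hb0 : Ideal.Quotient.mk p.toIdeal b = 0 := by
    have h : Ideal.Quotient.mk p.toIdeal b * Ideal.Quotient.mk p.toIdeal b = 0 := by
      rw [← map_mul, odd_sq (𝒜 := 𝒜) b hb, map_zero]
    exact mul_self_eq_zero.mp h
  rw [map_add, hb0, add_zero, ← map_mul, ← map_mul, even_comm' 𝒜 ha]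

/-! ### Krull super-dimension -/

/-- The annihilator in `A₀` of an element `b` of `A`. -/
def evenAnn (b : A) : Ideal (evenPart 𝒜) where
  carrier := {r | (r : A) * b = 0}
  add_mem' {r s} hr hs := by
    change ((r : A) + (s : A)) * b = 0
    rw [add_mul, show (r : A) * b = 0 from hr, show (s : A) * b = 0 from hs, add_zero]
  zero_mem' := zero_mul b
  smul_mem' c r hr := by
    change ((c : A) * (r : A)) * b = 0
    rw [mul_assoc, show (r : A) * b = 0 from hr, mul_zero]

/-- Odd elements `y₁, …, y_s` form a system of odd parameters if
`Kdim (A₀) = Kdim (A₀ ⧸ Ann_{A₀} (y₁ ⋯ y_s))`. -/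
def IsSystemOfOddParameters {s : ℕ} (y : Fin s → 𝒜 1) : Prop :=
  ringKrullDim (evenPart 𝒜) =
    ringKrullDim (evenPart 𝒜 ⧸ evenAnn 𝒜 (List.ofFn fun i => (y i : A)).prod)

/-- The even Krull dimension: the Krull dimension of `A₀` (which is `⊥` for the zero ring). -/
noncomputable def Ksdim₀ : WithBot ℕ∞ := ringKrullDim (evenPart 𝒜)

/-- The odd Krull dimension: the largest length of a system of odd parameters. For the zero ring
it is `0` by convention. -/
noncomputable def Ksdim₁ : ℕ∞ :=
  ⨆ s ∈ {s : ℕ | Nontrivial A ∧ ∃ y : Fin s → 𝒜 1, IsSystemOfOddParameters 𝒜 y}, (s : ℕ∞)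

/-- The Krull super-dimension `Ksdim₀ | Ksdim₁`, an element of the set of super-dimension vectors
with its lexicographic order. -/
noncomputable def Ksdim : WithBot ℕ∞ ×ₗ ℕ∞ := toLex (Ksdim₀ 𝒜, Ksdim₁ 𝒜)

/-! ### Localization -/

section Localization

variable (S : Submonoid (evenPart 𝒜))

/-- The homogeneous components `S⁻¹A_i` of `S⁻¹A`, for a multiplicative subset `S` of `A₀`. -/
def localizationGrading (i : ZMod 2) : AddSubgroup (LocalizedModule S A) where
  carrier := {x | ∃ a ∈ 𝒜 i, ∃ s : S, x = LocalizedModule.mk a s}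
  add_mem' := by
    rintro _ _ ⟨a, ha, s, rfl⟩ ⟨b, hb, t, rfl⟩
    have hmul : ∀ (u : S) (c : A), c ∈ 𝒜 i → u • c ∈ 𝒜 i := by
      intro u c hc
      have h := SetLike.mul_mem_graded (A := 𝒜) (show ((u : evenPart 𝒜) : A) ∈ 𝒜 0 from u.1.2) hc
      rwa [zero_add] at h
    exact ⟨_, add_mem (hmul t a ha) (hmul s b hb), _, LocalizedModule.mk_add_mk⟩
  zero_mem' := ⟨0, zero_mem _, 1, (LocalizedModule.zero_mk 1).symm⟩
  neg_mem' := by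
    rintro _ ⟨a, ha, s, rfl⟩
    exact ⟨_, neg_mem ha, s, LocalizedModule.mk_neg.symm⟩

theorem localization_smul_mem {i : ZMod 2} {c : A} (u : S) (hc : c ∈ 𝒜 i) : u • c ∈ 𝒜 i := by
  have h := SetLike.mul_mem_graded (A := 𝒜) (show ((u : evenPart 𝒜) : A) ∈ 𝒜 0 from u.1.2) hc
  rwa [zero_add] at h

/-- `S⁻¹A` is again a super-ring. -/
noncomputable instance localizationSuperRing : SuperRing (localizationGrading 𝒜 S) :=
  { gradedRingOfSum (localizationGrading 𝒜 S)
      { one_mem := ⟨1, SetLike.one_mem_graded 𝒜, 1, by rw [OreLocalization.one_def]⟩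
        mul_mem := by
          rintro i j _ _ ⟨a, ha, s, rfl⟩ ⟨b, hb, t, rfl⟩
          exact ⟨_, SetLike.mul_mem_graded ha hb, _, LocalizedModule.mk_mul_mk⟩ }
      (by
        intro x
        induction x with | _ m s
        obtain ⟨a, ha, b, hb, rfl⟩ := exists_add 𝒜 m
        refine ⟨_, ⟨a, ha, s, rfl⟩, _, ⟨b, hb, s, rfl⟩, ?_⟩
        rw [LocalizedModule.mk_add_mk, LocalizedModule.mk_eq]
        exact ⟨1, by simp only [smul_add, smul_smul]⟩)
      (by
        rintro _ ⟨a, ha, s, rfl⟩ ⟨b, hb, t, hab⟩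
        obtain ⟨u, hu⟩ := LocalizedModule.mk_eq.mp hab
        have h0 : u • t • a ∈ 𝒜 0 :=
          localization_smul_mem 𝒜 S u (localization_smul_mem 𝒜 S t ha)
        have h1 : u • t • a ∈ 𝒜 1 := by
          rw [hu]; exact localization_smul_mem 𝒜 S u (localization_smul_mem 𝒜 S s hb)
        have h := eq_zero_of_mem_mem 𝒜 h0 h1
        rw [← LocalizedModule.zero_mk (1 : S), LocalizedModule.mk_eq]
        exact ⟨u * t, by rw [one_smul, smul_zero, smul_zero, mul_smul, h]⟩) with
    even_comm := by
      rintro _ ⟨a, ha, s, rfl⟩ i _ ⟨b, hb, t, rfl⟩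
      rw [LocalizedModule.mk_mul_mk, LocalizedModule.mk_mul_mk, even_comm' 𝒜 ha, mul_comm s t]
    odd_sq := by
      rintro _ ⟨a, ha, s, rfl⟩
      rw [LocalizedModule.mk_mul_mk, odd_sq (𝒜 := 𝒜) a ha, LocalizedModule.zero_mk] }

variable {𝒜} in
/-- The multiplicative subset `A₀ \ 𝔭₀` of `A₀`, for a prime super-ideal `𝔭`. -/
def primeCompl (p : HomogeneousIdeal 𝒜) (hp : IsPrime p) : Submonoid (evenPart 𝒜) where
  carrier := {r | (r : A) ∉ p.toIdeal}
  one_mem' h := by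
    have : IsDomain (A ⧸ p.toIdeal) := hp
    exact one_ne_zero (α := A ⧸ p.toIdeal)
      ((map_one _).symm.trans (Ideal.Quotient.eq_zero_iff_mem.mpr h))
  mul_mem' {r s} hr hs h := by
    have : IsDomain (A ⧸ p.toIdeal) := hp
    have h' := Ideal.Quotient.eq_zero_iff_mem.mpr
      (show (r : A) * (s : A) ∈ p.toIdeal from h)
    rw [map_mul, mul_eq_zero, Ideal.Quotient.eq_zero_iff_mem, Ideal.Quotient.eq_zero_iff_mem] at h'
    exact h'.elim hr hs

variable {𝒜} in
/-- The localization `A_𝔭 = (A₀ \ 𝔭₀)⁻¹ A` at a prime super-ideal, with its grading. -/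
def atPrimeGrading (p : HomogeneousIdeal 𝒜) (hp : IsPrime p) :
    ZMod 2 → AddSubgroup (LocalizedModule (primeCompl p hp) A) :=
  localizationGrading 𝒜 (primeCompl p hp)

variable {𝒜} in
noncomputable instance (p : HomogeneousIdeal 𝒜) (hp : IsPrime p) :
    SuperRing (atPrimeGrading p hp) :=
  localizationSuperRing 𝒜 (primeCompl p hp)

end Localization

/-! ### Completion -/

section Completion

variable {𝒜}
variable (I : HomogeneousIdeal 𝒜)

/-- The `I`-adic completion `lim A ⧸ Iⁿ`, as the subring of compatible families in
`∏ n, A ⧸ Iⁿ`. -/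
def completion : Subring (∀ n : ℕ, A ⧸ I.toIdeal ^ n) where
  carrier := {x | ∀ (m n : ℕ) (h : m ≤ n),
    Ideal.Quotient.factor (Ideal.pow_le_pow_right (I := I.toIdeal) h) (x n) = x m}
  mul_mem' {x y} hx hy m n h := by
    rw [Pi.mul_apply, Pi.mul_apply, map_mul, hx m n h, hy m n h]
  one_mem' m n h := by rw [Pi.one_apply, Pi.one_apply, map_one]
  add_mem' {x y} hx hy m n h := by
    rw [Pi.add_apply, Pi.add_apply, map_add, hx m n h, hy m n h]
  zero_mem' m n h := by rw [Pi.zero_apply, Pi.zero_apply, map_zero]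
  neg_mem' {x} hx m n h := by rw [Pi.neg_apply, Pi.neg_apply, map_neg, hx m n h]

/-- The homogeneous components of the completion: `Â_i` consists of the compatible families
all of whose terms are classes of elements of `A_i`. -/
def completionGrading (i : ZMod 2) : AddSubgroup (completion I) where
  carrier := {x | ∀ n, ∃ a ∈ 𝒜 i, Ideal.Quotient.mk (I.toIdeal ^ n) a = x.1 n}
  add_mem' {x y} hx hy n := by
    obtain ⟨a, ha, hax⟩ := hx n
    obtain ⟨b, hb, hby⟩ := hy n
    exact ⟨a + b, add_mem ha hb, by rw [map_add, hax, hby]; rfl⟩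
  zero_mem' n := ⟨0, zero_mem _, by rw [map_zero]; rfl⟩
  neg_mem' {x} hx n := by
    obtain ⟨a, ha, hax⟩ := hx n
    exact ⟨-a, neg_mem ha, by rw [map_neg, hax]; rfl⟩

/-- Powers of a super-ideal are homogeneous. -/
theorem proj_mem_pow (n : ℕ) (i : ZMod 2) {x : A} (hx : x ∈ I.toIdeal ^ n) :
    GradedRing.proj 𝒜 i x ∈ I.toIdeal ^ n := by
  have hmem : ∀ (k : ZMod 2) (z : A), z ∈ I.toIdeal ^ n → z ∈ 𝒜 k →
      GradedRing.proj 𝒜 i z ∈ I.toIdeal ^ n := by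
    intro k z hz hk
    by_cases h : k = i
    · subst h
      rw [GradedRing.proj_apply, DirectSum.decompose_of_mem_same 𝒜 hk]
      exact hz
    · rw [GradedRing.proj_apply, DirectSum.decompose_of_mem_ne 𝒜 hk h]
      exact zero_mem _
  have hs : ∀ a : A, GradedRing.proj 𝒜 0 a + GradedRing.proj 𝒜 1 a = a :=
    fun a => proj_add_proj 𝒜 a
  have hh : ∀ x ∈ I.toIdeal ^ n, ∃ a b : A, a ∈ 𝒜 0 ∧ a ∈ I.toIdeal ^ n ∧ b ∈ 𝒜 1 ∧
      b ∈ I.toIdeal ^ n ∧ a + b = x := by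
    clear hmem hx x
    induction n with
    | zero =>
      intro x _
      obtain ⟨a, ha, b, hb, h⟩ := exists_add 𝒜 x
      refine ⟨a, b, ha, ?_, hb, ?_, h⟩ <;>
      · rw [Submodule.pow_zero, Ideal.one_eq_top]; trivial
    | succ n ih =>
      intro x hx
      rw [Ideal.IsTwoSided.pow_succ] at hx ⊢
      refine Submodule.mul_induction_on hx ?_ ?_
      · intro a ha b hb
        obtain ⟨b0, b1, hb0, hb0', hb1, hb1', rfl⟩ := ih b hb
        have h0 : GradedRing.proj 𝒜 0 a ∈ I.toIdeal := I.isHomogeneous 0 ha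
        have h1 : GradedRing.proj 𝒜 1 a ∈ I.toIdeal := I.isHomogeneous 1 ha
        have m0 : GradedRing.proj 𝒜 0 a ∈ 𝒜 0 := SetLike.coe_mem _
        have m1 : GradedRing.proj 𝒜 1 a ∈ 𝒜 1 := SetLike.coe_mem _
        have e := hs a
        refine ⟨GradedRing.proj 𝒜 0 a * b0 + GradedRing.proj 𝒜 1 a * b1,
          GradedRing.proj 𝒜 0 a * b1 + GradedRing.proj 𝒜 1 a * b0, ?_, ?_, ?_, ?_, ?_⟩
        · exact add_mem (SetLike.mul_mem_graded (A := 𝒜) (i := 0) (j := 0) m0 hb0)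
            (SetLike.mul_mem_graded (A := 𝒜) (i := 1) (j := 1) m1 hb1)
        · exact add_mem (Ideal.mul_mem_mul h0 hb0') (Ideal.mul_mem_mul h1 hb1')
        · exact add_mem (SetLike.mul_mem_graded (A := 𝒜) (i := 0) (j := 1) m0 hb1)
            (SetLike.mul_mem_graded (A := 𝒜) (i := 1) (j := 0) m1 hb0)
        · exact add_mem (Ideal.mul_mem_mul h0 hb1') (Ideal.mul_mem_mul h1 hb0')
        · conv_rhs => rw [← e]
          noncomm_ring
      · rintro _ _ ⟨a, b, ha, ha', hb, hb', rfl⟩ ⟨c, d, hc, hc', hd, hd', rfl⟩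
        exact ⟨a + c, b + d, add_mem ha hc, add_mem ha' hc', add_mem hb hd, add_mem hb' hd',
          by abel⟩
  obtain ⟨a, b, ha, ha', hb, hb', rfl⟩ := hh x hx
  rw [map_add]
  exact add_mem (hmem 0 a ha' ha) (hmem 1 b hb' hb)

/-- The projection onto the component of parity `i`, induced on `A ⧸ Iⁿ`. -/
def quotientProj (n : ℕ) (i : ZMod 2) : (A ⧸ I.toIdeal ^ n) →+ (A ⧸ I.toIdeal ^ n) :=
  QuotientAddGroup.map _ _ (GradedRing.proj 𝒜 i) (fun _ hx => proj_mem_pow I n i hx)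

theorem quotientProj_mk (n : ℕ) (i : ZMod 2) (a : A) :
    quotientProj I n i (Ideal.Quotient.mk _ a) = Ideal.Quotient.mk _ (GradedRing.proj 𝒜 i a) :=
  rfl

/-- The `I`-adic completion is again a super-ring. -/
noncomputable instance completionSuperRing : SuperRing (completionGrading I) :=
  { gradedRingOfSum (completionGrading I)
      { one_mem := fun n => ⟨1, SetLike.one_mem_graded 𝒜, by rw [map_one]; rfl⟩
        mul_mem := by
          intro i j x y hx hy n
          obtain ⟨a, ha, hax⟩ := hx n
          obtain ⟨b, hb, hby⟩ := hy n
          exact ⟨a * b, SetLike.mul_mem_graded ha hb, by rw [map_mul, hax, hby]; rfl⟩ }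
      (by
        intro x
        have hc : ∀ i : ZMod 2, (fun n => quotientProj I n i (x.1 n)) ∈ completion I := by
          intro i m n h
          obtain ⟨a, ha⟩ := Ideal.Quotient.mk_surjective (x.1 n)
          have hx := x.2 m n h
          change Ideal.Quotient.factor _ (quotientProj I n i (x.1 n)) = quotientProj I m i (x.1 m)
          rw [← ha] at hx ⊢
          rw [← hx]
          rfl
        have hg : ∀ i : ZMod 2, (⟨_, hc i⟩ : completion I) ∈ completionGrading I i := by
          intro i n
          obtain ⟨a, ha⟩ := Ideal.Quotient.mk_surjective (x.1 n)
          refine ⟨GradedRing.proj 𝒜 i a, SetLike.coe_mem _, ?_⟩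
          change _ = quotientProj I n i (x.1 n)
          rw [← ha]
          rfl
        refine ⟨_, hg 0, _, hg 1, Subtype.ext (funext fun n => ?_)⟩
        change quotientProj I n 0 (x.1 n) + quotientProj I n 1 (x.1 n) = x.1 n
        obtain ⟨a, ha⟩ := Ideal.Quotient.mk_surjective (x.1 n)
        rw [← ha, quotientProj_mk, quotientProj_mk, ← map_add]
        congr 1
        exact proj_add_proj 𝒜 a)
      (by
        intro x h0 h1
        refine Subtype.ext (funext fun n => ?_)
        obtain ⟨a, ha, hax⟩ := h0 n
        obtain ⟨b, hb, hbx⟩ := h1 n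
        have ea : quotientProj I n 0 (x.1 n) = x.1 n := by
          rw [← hax, quotientProj_mk, GradedRing.proj_apply,
            DirectSum.decompose_of_mem_same 𝒜 ha]
        have eb : quotientProj I n 0 (x.1 n) = 0 := by
          rw [← hbx, quotientProj_mk, GradedRing.proj_apply,
            DirectSum.decompose_of_mem_ne 𝒜 hb (by decide), map_zero]
        rw [← ea, eb]
        rfl) with
    even_comm := by
      intro x hx i y hy
      refine Subtype.ext (funext fun n => ?_)
      obtain ⟨a, ha, hax⟩ := hx n
      obtain ⟨b, hb, hby⟩ := hy n
      change x.1 n * y.1 n = y.1 n * x.1 n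
      rw [← hax, ← hby, ← map_mul, ← map_mul, even_comm' 𝒜 ha]
    odd_sq := by
      intro x hx
      refine Subtype.ext (funext fun n => ?_)
      obtain ⟨a, ha, hax⟩ := hx n
      change x.1 n * x.1 n = 0
      rw [← hax, ← map_mul, odd_sq (𝒜 := 𝒜) a ha, map_zero] }

end Completion

end SuperRing

/-!
The even ring `R = A₀` is Noetherian and `A` is a finite `R`-module. Put `J = I ∩ R`. Products of two
odd elements are even, so `I ^ (2 n) ⊆ J ^ n A ⊆ I ^ n`, and the completion of `A` is the
base change of `A` along the flat map `R → R̂` to the `J`-adic completion; the localization `A_𝔭`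
is the base change of `A` along the flat map `R → R_𝔭₀`. Flatness means that the annihilator of a
product of odd elements of `A` extends to that of its image in either base change, and every product
of `s` odd elements of the base change is a combination of images of such products.

When `Ksdim₀ < ∞`, `Ksdim` is the supremum of the pairs `n | s` for which the annihilator in the
even part of some product of `s` odd elements lies below a chain of `n + 1` primes. For `A_𝔭` these
are chains of primes of `R` inside `𝔭₀`. For the completion, a chain above an extended ideal ends
below a maximal ideal `M ⊇ J R̂`; the ideal `M` is extended from its contraction, and comparing
heights moves the chain to one of the same length in `R` inside `M ∩ R ⊇ J`, while going down lifts
chains inside a prime containing `J` back to `R̂`. Since the prime super-ideals are the ideals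
`q ⊕ A₁` with `q` a prime of `R`, both sides of the theorem are suprema of the same pairs.
-/

section AdicallyComplete

variable {R S σ : Type*} [CommRing R] [CommRing S] [Algebra R S]

theorem map_aeval_idealOfVars (a : σ → S) :
    (MvPolynomial.idealOfVars σ R).map (MvPolynomial.aeval (R := R) a) =
      Ideal.span (Set.range a) := by
  rw [MvPolynomial.idealOfVars, Ideal.map_span, ← Set.range_comp]
  congr 2
  exact funext fun i => MvPolynomial.aeval_X a i

theorem exists_mvPowerSeries_ringHom_coe_eq_aeval [Finite σ] (a : σ → S)
    [IsAdicComplete (Ideal.span (Set.range a)) S] :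
    ∃ φ : MvPowerSeries σ R →+* S,
      ∀ p : MvPolynomial σ R, φ p = MvPolynomial.aeval a p := by
  let X := MvPolynomial.idealOfVars σ R
  let ev : MvPolynomial σ R →+* S := MvPolynomial.aeval (R := R) a
  have hX (n : ℕ) : X ^ n ≤ (Ideal.span (Set.range a) ^ n).comap ev := by
    rw [← Ideal.map_le_iff_le_comap, Ideal.map_pow]
    exact (congrArg (· ^ n) (map_aeval_idealOfVars a)).le
  let f (n : ℕ) : AdicCompletion X (MvPolynomial σ R) →+* S ⧸ Ideal.span (Set.range a) ^ n :=
    (Ideal.quotientMap _ ev (hX n)).comp (AdicCompletion.evalₐ X n : _ →+* _)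
  have hf {m n : ℕ} (h : m ≤ n) : (Ideal.Quotient.factorPow _ h).comp (f n) = f m := by
    ext x
    obtain ⟨x, rfl⟩ := AdicCompletion.mk_surjective X (MvPolynomial σ R) x
    exact congrArg (Ideal.quotientMap _ ev (hX m)) (AdicCompletion.Ideal.mk_eq_mk X h x)
  refine ⟨(IsAdicComplete.liftRingHom _ f hf).comp
    (MvPowerSeries.toAdicCompletionAlgEquiv σ R : _ →+* _), congrFun ?_⟩
  refine IsHausdorff.funext' (Ideal.span (Set.range a)) fun n p => ?_
  rw [RingHom.comp_apply, IsAdicComplete.mk_liftRingHom, RingHom.coe_coe,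
    MvPowerSeries.toAdicCompletionAlgEquiv_apply, MvPowerSeries.toAdicCompletion_coe,
    RingHom.comp_apply, RingHom.coe_coe, AdicCompletion.evalₐ_of, Ideal.quotientMap_mk]
  rfl

theorem isNoetherianRing_of_isAdicComplete [IsNoetherianRing R] {K : Ideal S} (hK : K.FG)
    [IsAdicComplete K S] (hRS : Function.Surjective (algebraMap R (S ⧸ K))) :
    IsNoetherianRing S := by
  obtain ⟨n, a, rfl⟩ := Submodule.fg_iff_exists_fin_generating_family.mp hK
  obtain ⟨φ, hφ⟩ := exists_mvPowerSeries_ringHom_coe_eq_aeval (R := R) a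
  have hX : (Ideal.span (Set.range MvPowerSeries.X)).map φ = Ideal.span (Set.range a) := by
    rw [Ideal.map_span, ← Set.range_comp]
    congr 2
    ext1 i
    rw [Function.comp_apply, ← MvPolynomial.coe_X, hφ, MvPolynomial.aeval_X]
  have : IsHausdorff ((Ideal.span (Set.range MvPowerSeries.X)).map φ) S := by
    rw [hX]; exact IsAdicComplete.toIsHausdorff
  refine isNoetherianRing_of_surjective _ _ φ
    (surjective_of_mk_map_comp_surjective (I := Ideal.span (Set.range MvPowerSeries.X)) φ ?_)
  refine Ideal.Quotient.mk_surjective.forall.mpr fun x => ?_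
  obtain ⟨r, hr⟩ := hRS (Ideal.Quotient.mk _ x)
  refine ⟨(MvPolynomial.C r : MvPolynomial (Fin n) R), ?_⟩
  rw [RingHom.comp_apply, hφ, MvPolynomial.aeval_C, Ideal.Quotient.eq, hX]
  exact Ideal.Quotient.eq.mp hr

end AdicallyComplete

section PrimeChains

variable {R S : Type*} [CommRing R] [CommRing S]

/-- There is a chain `p₀ < ⋯ < pₙ` of prime ideals with `a ≤ p₀` and `pₙ ≤ b`. Taking `b = ⊤`
leaves the top of the chain unconstrained. -/
def HasPrimeChain (a b : Ideal R) (n : ℕ) : Prop :=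
  ∃ c : LTSeries (PrimeSpectrum R), c.length = n ∧ a ≤ c.head.asIdeal ∧ c.last.asIdeal ≤ b

theorem HasPrimeChain.mono {a a' b b' : Ideal R} {n : ℕ} (h : HasPrimeChain a b n) (ha : a' ≤ a)
    (hb : b ≤ b') : HasPrimeChain a' b' n := by
  obtain ⟨c, hc, hac, hcb⟩ := h
  exact ⟨c, hc, ha.trans hac, hcb.trans hb⟩

theorem natCast_le_height_iff_hasPrimeChain (p : Ideal R) [p.IsPrime] (n : ℕ) :
    n ≤ p.height ↔ HasPrimeChain ⊥ p n := by
  have hp : p.height = Order.height (⟨p, ‹_›⟩ : PrimeSpectrum R) :=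
    PrimeSpectrum.height_eq_orderHeight ⟨p, ‹_›⟩
  rw [hp]
  constructor
  · intro h
    obtain ⟨c, hc, hn⟩ := Order.exists_series_of_le_height _ h
    exact ⟨c, hn, bot_le, by rw [hc]⟩
  · rintro ⟨c, rfl, -, hc⟩
    exact Order.length_le_height hc

theorem natCast_le_ringKrullDim_iff_hasPrimeChain (n : ℕ) :
    n ≤ ringKrullDim R ↔ HasPrimeChain (⊥ : Ideal R) ⊤ n := by
  simp only [ringKrullDim, Order.le_krullDim_iff, HasPrimeChain, bot_le, le_top, and_true]

theorem comap_le_comap_iff_of_map_comap_eq {φ : R →+* S}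
    (hφ : ∀ K : Ideal S, (K.comap φ).map φ = K) {K L : Ideal S} :
    K.comap φ ≤ L.comap φ ↔ K ≤ L :=
  ⟨fun h => hφ L ▸ hφ K ▸ Ideal.map_mono h, fun h => Ideal.comap_mono h⟩

theorem hasPrimeChain_map_iff {φ : R →+* S} (hφ : ∀ K : Ideal S, (K.comap φ).map φ = K)
    {a : Ideal R} {b : Ideal S}
    (hab : ∀ p : PrimeSpectrum R, a ≤ p.asIdeal → p.asIdeal ≤ b.comap φ →
      p ∈ Set.range (PrimeSpectrum.comap φ)) (n : ℕ) :
    HasPrimeChain (a.map φ) b n ↔ HasPrimeChain a (b.comap φ) n := by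
  let e : PrimeSpectrum S ↪o PrimeSpectrum R :=
    OrderEmbedding.ofMapLEIff (PrimeSpectrum.comap φ) fun _ _ =>
      comap_le_comap_iff_of_map_comap_eq hφ
  constructor
  · rintro ⟨c, hc, hac, hcb⟩
    refine ⟨c.map e e.strictMono, hc, ?_, ?_⟩
    · rw [LTSeries.head_map]; exact Ideal.map_le_iff_le_comap.mp hac
    · rw [LTSeries.last_map]; exact Ideal.comap_mono hcb
  · rintro ⟨c, hc, hac, hcb⟩
    have hrange (i : Fin (c.length + 1)) : ∃ q, e q = c i :=
      hab (c i) (hac.trans (c.head_le i)) (le_trans (c.monotone (Fin.le_last i)) hcb)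
    choose d hd using hrange
    refine ⟨⟨c.length, d, fun i => e.lt_iff_lt.mp ?_⟩, hc,
      Ideal.map_le_iff_le_comap.mpr (hac.trans_eq ?_),
      (comap_le_comap_iff_of_map_comap_eq hφ).mp (Eq.trans_le ?_ hcb)⟩
    · rw [hd, hd]; exact c.step i
    · exact congrArg PrimeSpectrum.asIdeal (hd 0).symm
    · exact congrArg PrimeSpectrum.asIdeal (hd (Fin.last _))

theorem hasPrimeChain_comap_quotientMk_iff (a : Ideal R) (b : Ideal (R ⧸ a)) (n : ℕ) :
    HasPrimeChain a (b.comap (Ideal.Quotient.mk a)) n ↔ HasPrimeChain ⊥ b n := by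
  rw [← hasPrimeChain_map_iff (Ideal.map_comap_of_surjective _ Ideal.Quotient.mk_surjective),
    Ideal.map_quotient_self]
  intro p hp _
  rwa [range_comap_of_surjective _ _ Ideal.Quotient.mk_surjective, Ideal.mk_ker]

theorem natCast_le_ringKrullDim_quotient_iff_hasPrimeChain (a : Ideal R) (n : ℕ) :
    n ≤ ringKrullDim (R ⧸ a) ↔ HasPrimeChain a ⊤ n := by
  rw [natCast_le_ringKrullDim_iff_hasPrimeChain, ← hasPrimeChain_comap_quotientMk_iff,
    Ideal.comap_top]

theorem hasPrimeChain_map_algebraMap_atPrime_iff [Algebra R S] (p : Ideal R) [p.IsPrime]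
    [IsLocalization.AtPrime S p] (a : Ideal R) (n : ℕ) :
    HasPrimeChain (a.map (algebraMap R S)) ⊤ n ↔ HasPrimeChain a p n := by
  have := IsLocalization.AtPrime.isLocalRing S p
  have hcomap : (IsLocalRing.maximalIdeal S).comap (algebraMap R S) = p :=
    IsLocalization.AtPrime.under_maximalIdeal S p
  have hle_max : HasPrimeChain (a.map (algebraMap R S)) ⊤ n ↔
      HasPrimeChain (a.map (algebraMap R S)) (IsLocalRing.maximalIdeal S) n :=
    ⟨fun ⟨c, hc, hac, _⟩ => ⟨c, hc, hac, IsLocalRing.le_maximalIdeal c.last.2.ne_top⟩,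
      fun h => h.mono le_rfl le_top⟩
  rw [hle_max, hasPrimeChain_map_iff (IsLocalization.map_under p.primeCompl S), hcomap]
  intro q _ hq
  rw [hcomap] at hq
  rw [PrimeSpectrum.localization_comap_range S p.primeCompl]
  exact Set.disjoint_left.mpr fun r hr hrq => hr (hq hrq)

theorem height_le_height_of_map_eq [Algebra R S] [IsNoetherianRing R] [IsNoetherianRing S]
    {p : Ideal R} [p.IsPrime] {P : Ideal S} [P.IsPrime] [P.LiesOver p]
    (hP : p.map (algebraMap R S) = P) : P.height ≤ p.height := by
  have h := Ideal.height_le_height_add_of_liesOver p P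
  rwa [hP, Ideal.map_quotient_self, Ideal.height_bot, add_zero] at h

theorem natCast_le_height_map_quotientMk_iff_hasPrimeChain {a p : Ideal R} [p.IsPrime]
    (hap : a ≤ p) (n : ℕ) :
    n ≤ (p.map (Ideal.Quotient.mk a)).height ↔ HasPrimeChain a p n := by
  have hprime : (p.map (Ideal.Quotient.mk a)).IsPrime :=
    Ideal.isPrime_map_quotientMk_of_isPrime hap
  rw [natCast_le_height_iff_hasPrimeChain, ← hasPrimeChain_comap_quotientMk_iff,
    Ideal.comap_map_mk hap]

theorem HasPrimeChain.under [Algebra R S] [IsNoetherianRing R] [IsNoetherianRing S]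
    {a P : Ideal S} [P.IsPrime] (haP : a ≤ P) (hP : (P.under R).map (algebraMap R S) = P) {n : ℕ}
    (h : HasPrimeChain a P n) : HasPrimeChain (a.under R) (P.under R) n := by
  have hle : a.under R ≤ P.under R := Ideal.comap_mono haP
  rw [← natCast_le_height_map_quotientMk_iff_hasPrimeChain haP] at h
  rw [← natCast_le_height_map_quotientMk_iff_hasPrimeChain hle]
  have hprimeP := Ideal.isPrime_map_quotientMk_of_isPrime haP
  have hprime := Ideal.isPrime_map_quotientMk_of_isPrime hle
  have hmk : (algebraMap (R ⧸ a.under R) (S ⧸ a)).comp (Ideal.Quotient.mk _) =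
      (Ideal.Quotient.mk a).comp (algebraMap R S) := rfl
  have hover : (P.map (Ideal.Quotient.mk a)).LiesOver
      ((P.under R).map (Ideal.Quotient.mk (a.under R))) := by
    refine ⟨?_⟩
    refine Ideal.comap_injective_of_surjective _ Ideal.Quotient.mk_surjective ?_
    rw [Ideal.comap_map_mk hle, Ideal.under_def (R ⧸ a.under R), Ideal.comap_comap, hmk,
      ← Ideal.comap_comap, Ideal.comap_map_mk haP]
  exact h.trans (height_le_height_of_map_eq (by rw [Ideal.map_map, hmk, ← Ideal.map_map, hP]))

theorem HasPrimeChain.map [Algebra R S] [Algebra.HasGoingDown R S] {a p : Ideal R} (P : Ideal S)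
    [p.IsPrime] [P.IsPrime] [P.LiesOver p] {n : ℕ} (h : HasPrimeChain a p n) :
    HasPrimeChain (a.map (algebraMap R S)) P n := by
  obtain ⟨c, hc, hac, hcp⟩ := h
  obtain ⟨Q, hQP, hQ, hQc⟩ := Ideal.exists_ideal_le_liesOver_of_le P hcp
  obtain ⟨d, hd, hdQ, hdc⟩ := Ideal.exists_ltSeries_of_hasGoingDown c Q
  refine ⟨d, hd.trans hc, Ideal.map_le_iff_le_comap.mpr ?_, by rwa [hdQ]⟩
  have hhead : PrimeSpectrum.comap (algebraMap R S) d.head = c.head := by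
    have h := congrArg List.head? hdc
    rw [List.head?_map, List.head?_eq_some_head d.toList_ne_nil,
      List.head?_eq_some_head c.toList_ne_nil, RelSeries.head_toList, RelSeries.head_toList] at h
    exact Option.some_injective _ h
  exact hac.trans_eq (congrArg PrimeSpectrum.asIdeal hhead.symm)

theorem map_under_eq_of_map_le [Algebra R S] {J : Ideal R}
    (hRS : Function.Surjective (algebraMap R (S ⧸ J.map (algebraMap R S)))) {K : Ideal S}
    (hK : J.map (algebraMap R S) ≤ K) : (K.under R).map (algebraMap R S) = K := by
  refine le_antisymm Ideal.map_comap_le fun x hx => ?_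
  obtain ⟨r, hr⟩ := hRS (Ideal.Quotient.mk _ x)
  have hrx : algebraMap R S r - x ∈ J.map (algebraMap R S) := Ideal.Quotient.eq.mp hr
  have hrK : r ∈ K.under R := (Submodule.sub_mem_iff_left K hx).mp (hK hrx)
  refine (Submodule.sub_mem_iff_right _ (Ideal.mem_map_of_mem _ hrK)).mp
    (Ideal.map_mono (Ideal.map_le_iff_le_comap.mp hK) hrx)

section AdicCompletion

variable (J : Ideal R)

theorem algebraMap_adicCompletion_quotient_map_surjective (hJ : J.FG) :
    Function.Surjective
      (algebraMap R (AdicCompletion J R ⧸ J.map (algebraMap R (AdicCompletion J R)))) := by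
  refine Ideal.Quotient.mk_surjective.forall.mpr fun x => ?_
  obtain ⟨r, hr⟩ := Ideal.Quotient.mk_surjective (AdicCompletion.evalOneₐ J x)
  refine ⟨r, Ideal.Quotient.eq.mpr ?_⟩
  rw [← AdicCompletion.ker_evalOneₐ_eq_map J hJ]
  refine (map_sub (AdicCompletion.evalOneₐ J) _ _).trans (sub_eq_zero.mpr ?_)
  exact ((AdicCompletion.evalOneₐ J).commutes r).trans hr

theorem isNoetherianRing_adicCompletion [IsNoetherianRing R] :
    IsNoetherianRing (AdicCompletion J R) :=
  have hJ : J.FG := IsNoetherian.noetherian J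
  have := AdicCompletion.isAdicComplete_self J hJ
  isNoetherianRing_of_isAdicComplete (hJ.map _)
    (algebraMap_adicCompletion_quotient_map_surjective J hJ)

theorem map_algebraMap_adicCompletion_le_of_isMaximal (hJ : J.FG)
    (M : Ideal (AdicCompletion J R)) [hM : M.IsMaximal] :
    J.map (algebraMap R (AdicCompletion J R)) ≤ M :=
  have := AdicCompletion.isAdicComplete_self J hJ
  (IsAdicComplete.le_jacobson_bot _).trans (sInf_le ⟨bot_le, hM⟩)

theorem exists_isPrime_liesOver_adicCompletion (p : Ideal R) [p.IsPrime] (hJp : J ≤ p) :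
    ∃ P : Ideal (AdicCompletion J R), P.IsPrime ∧ P.LiesOver p := by
  have := Ideal.isPrime_map_quotientMk_of_isPrime hJp
  refine ⟨(p.map (Ideal.Quotient.mk J)).comap (AdicCompletion.evalOneₐ J), inferInstance, ⟨?_⟩⟩
  exact (Ideal.comap_map_mk hJp).symm

theorem hasPrimeChain_map_adicCompletion_iff [IsNoetherianRing R] (a : Ideal R) (n : ℕ) :
    HasPrimeChain (a.map (algebraMap R (AdicCompletion J R))) ⊤ n ↔
      ∃ p : PrimeSpectrum R, J ≤ p.asIdeal ∧ HasPrimeChain a p.asIdeal n := by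
  have hJ : J.FG := IsNoetherian.noetherian J
  have := isNoetherianRing_adicCompletion J
  constructor
  · rintro ⟨c, hc, hac, -⟩
    obtain ⟨M, hM, hcM⟩ := c.last.asIdeal.exists_le_maximal c.last.2.ne_top
    have hJM := map_algebraMap_adicCompletion_le_of_isMaximal J hJ M
    have hMR := map_under_eq_of_map_le
      (algebraMap_adicCompletion_quotient_map_surjective J hJ) hJM
    have hchain : HasPrimeChain (a.map (algebraMap R (AdicCompletion J R))) M n :=
      ⟨c, hc, hac, hcM⟩
    have haM := hac.trans (le_trans c.head_le_last hcM)
    exact ⟨⟨M.under R, inferInstance⟩, Ideal.map_le_iff_le_comap.mp hJM,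
      (hchain.under haM hMR).mono Ideal.le_comap_map le_rfl⟩
  · rintro ⟨p, hJp, h⟩
    obtain ⟨P, hP, hPp⟩ := exists_isPrime_liesOver_adicCompletion J p.asIdeal hJp
    exact (h.map P).mono le_rfl le_top

end AdicCompletion

end PrimeChains

section TorsionIdeals

open TensorProduct

variable {R M : Type*} [CommRing R] [AddCommGroup M] [Module R M]

theorem rid_lTensor_subtype_mem_map {S : Type*} [CommRing S] [Algebra R S] (a : Ideal R)
    (z : S ⊗[R] a) :
    TensorProduct.rid R S (a.subtype.lTensor S z) ∈ a.map (algebraMap R S) := by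
  induction z with
  | zero => simp only [map_zero, zero_mem]
  | add x y hx hy => rw [map_add, map_add]; exact add_mem hx hy
  | tmul s r =>
    rw [LinearMap.lTensor_tmul, TensorProduct.rid_tmul, Algebra.smul_def]
    exact Ideal.mul_mem_right _ _ (Ideal.mem_map_of_mem _ r.2)

theorem torsionOf_eq_map_of_isBaseChange {S N : Type*} [CommRing S] [Algebra R S]
    [Module.Flat R S] [AddCommGroup N] [Module R N] [Module S N] [IsScalarTower R S N]
    {f : M →ₗ[R] N} (hf : IsBaseChange S f) (y : M) :
    Ideal.torsionOf S N (f y) = (Ideal.torsionOf R M y).map (algebraMap R S) := by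
  refine le_antisymm (fun t ht => ?_) (Ideal.map_le_iff_le_comap.mpr fun r hr => ?_)
  · have hty : t ⊗ₜ[R] y = 0 := hf.equiv.injective <| by
      rw [hf.equiv_tmul, map_zero]; exact ht
    have hexact := Module.Flat.lTensor_exact S
      (LinearMap.exact_subtype_ker_map (LinearMap.toSpanSingleton R M y))
    obtain ⟨z, hz⟩ := (hexact (t ⊗ₜ 1)).mp <| by
      rw [LinearMap.lTensor_tmul, LinearMap.toSpanSingleton_apply, one_smul, hty]
    have hmem : TensorProduct.rid R S (t ⊗ₜ[R] (1 : R)) ∈ _ :=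
      hz ▸ rid_lTensor_subtype_mem_map (Ideal.torsionOf R M y) z
    rwa [TensorProduct.rid_tmul, one_smul] at hmem
  · rw [Ideal.mem_torsionOf_iff] at hr
    rw [Ideal.mem_comap, Ideal.mem_torsionOf_iff, algebraMap_smul, ← map_smul, hr, map_zero]

theorem exists_torsionOf_le_of_mem_span {T : Set M} {P : Ideal R} [P.IsPrime] {y : M}
    (hy : y ∈ Submodule.span R T) (hyP : Ideal.torsionOf R M y ≤ P) :
    ∃ z ∈ T, Ideal.torsionOf R M z ≤ P := by
  by_contra! hT
  have hle : Submodule.span R T ≤ Submodule.torsion' R M P.primeCompl :=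
    Submodule.span_le.mpr fun z hz =>
      have ⟨r, hr, hrP⟩ := SetLike.not_le_iff_exists.mp (hT z hz)
      ⟨⟨r, hrP⟩, hr⟩
  obtain ⟨r, hr⟩ := (Submodule.mem_torsion'_iff _ y).mp (hle hy)
  exact r.2 (hyP hr)

end TorsionIdeals

theorem HasPrimeChain.exists_of_mem_span {R M : Type*} [CommRing R] [AddCommGroup M] [Module R M]
    {T : Set M} {y : M} (hy : y ∈ Submodule.span R T) {b : Ideal R} {n : ℕ}
    (h : HasPrimeChain (Ideal.torsionOf R M y) b n) :
    ∃ z ∈ T, HasPrimeChain (Ideal.torsionOf R M z) b n := by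
  obtain ⟨c, hc, hac, hcb⟩ := h
  obtain ⟨z, hz, hzc⟩ := exists_torsionOf_le_of_mem_span hy hac
  exact ⟨z, hz, c, hc, hzc, hcb⟩

namespace SuperRing

section SuperDimension

open scoped Pointwise

variable {A : Type*} [Ring A] (𝒜 : ZMod 2 → AddSubgroup A) [SuperRing 𝒜]

theorem evenAnn_one : evenAnn 𝒜 1 = ⊥ :=
  eq_bot_iff.mpr fun r hr => Subtype.ext ((mul_one (r : A)).symm.trans hr)

/-- There are `s` odd elements whose product has its annihilator in `A₀` below a chain of `n + 1`
primes lying inside `q`. For `q = ⊤` these are the pairs that bound `Ksdim` from below. -/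
def HasOddChain (q : Ideal (evenPart 𝒜)) (n s : ℕ) : Prop :=
  ∃ y ∈ (𝒜 1 : Set A) ^ s, HasPrimeChain (evenAnn 𝒜 y) q n

variable {𝒜}

theorem HasOddChain.natCast_le_Ksdim₀ {n s : ℕ} (h : HasOddChain 𝒜 ⊤ n s) : n ≤ Ksdim₀ 𝒜 := by
  obtain ⟨y, -, h⟩ := h
  exact (natCast_le_ringKrullDim_iff_hasPrimeChain n).mpr (h.mono bot_le le_rfl)

theorem hasOddChain_zero_iff (n : ℕ) : HasOddChain 𝒜 ⊤ n 0 ↔ n ≤ Ksdim₀ 𝒜 := by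
  refine ⟨HasOddChain.natCast_le_Ksdim₀, fun h => ⟨1, by rw [pow_zero]; rfl, ?_⟩⟩
  rw [evenAnn_one]
  exact (natCast_le_ringKrullDim_iff_hasPrimeChain n).mp h

theorem Ksdim₀_le_of_forall_hasOddChain {d : WithBot ℕ∞}
    (h : ∀ n, HasOddChain 𝒜 ⊤ n 0 → (n : WithBot ℕ∞) ≤ d) : Ksdim₀ 𝒜 ≤ d :=
  iSup_le fun c => h _ ((hasOddChain_zero_iff _).mpr (Order.le_krullDim_iff.mpr ⟨c, rfl⟩))

theorem exists_isSystemOfOddParameters_iff_hasOddChain {n : ℕ} (hn : Ksdim₀ 𝒜 = n) (s : ℕ) :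
    (∃ y : Fin s → 𝒜 1, IsSystemOfOddParameters 𝒜 y) ↔ HasOddChain 𝒜 ⊤ n s := by
  have hdim (y : A) : ringKrullDim (evenPart 𝒜) = ringKrullDim (evenPart 𝒜 ⧸ evenAnn 𝒜 y) ↔
      HasPrimeChain (evenAnn 𝒜 y) ⊤ n := by
    rw [← natCast_le_ringKrullDim_quotient_iff_hasPrimeChain, ← hn, Ksdim₀]
    exact ⟨Eq.le, fun h => h.antisymm (ringKrullDim_quotient_le _)⟩
  simp only [HasOddChain, Set.mem_pow, IsSystemOfOddParameters, hdim]
  exact ⟨fun ⟨y, hy⟩ => ⟨_, ⟨y, rfl⟩, hy⟩, fun ⟨_, ⟨y, rfl⟩, hy⟩ => ⟨y, hy⟩⟩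

theorem Ksdim₀_eq_bot_iff : Ksdim₀ 𝒜 = ⊥ ↔ Subsingleton A := by
  rw [Ksdim₀, ringKrullDim, Order.krullDim_eq_bot_iff, PrimeSpectrum.isEmpty_iff_subsingleton]
  exact ⟨fun h => subsingleton_of_zero_eq_one (congrArg Subtype.val (h.elim (0 : evenPart 𝒜) 1)),
    fun _ => inferInstance⟩

theorem exists_Ksdim₀_eq_natCast [Nontrivial A] (h : Ksdim₀ 𝒜 < ⊤) : ∃ n : ℕ, Ksdim₀ 𝒜 = n := by
  have hbot : Ksdim₀ 𝒜 ≠ ⊥ := Ksdim₀_eq_bot_iff.not.mpr (not_subsingleton A)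
  obtain ⟨d, hd⟩ := WithBot.ne_bot_iff_exists.mp hbot
  rw [← hd] at h
  obtain ⟨n, rfl⟩ := ENat.ne_top_iff_exists.mp (WithBot.coe_lt_coe.mp h).ne
  exact ⟨n, hd.symm⟩

theorem Ksdim_eq_bot [Subsingleton A] : Ksdim 𝒜 = ⊥ := by
  have h₀ : Ksdim₀ 𝒜 = ⊥ := Ksdim₀_eq_bot_iff.mpr ‹_›
  have h₁ : Ksdim₁ 𝒜 = 0 :=
    nonpos_iff_eq_zero.mp (iSup₂_le fun s hs => absurd hs.1 (not_nontrivial A))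
  rw [Ksdim, h₀, h₁]
  rfl

theorem Ksdim₁_eq_iSup_hasOddChain [Nontrivial A] {n : ℕ} (hn : Ksdim₀ 𝒜 = n) :
    Ksdim₁ 𝒜 = ⨆ s ∈ {s | HasOddChain 𝒜 ⊤ n s}, (s : ℕ∞) := by
  simp only [Ksdim₁, ‹Nontrivial A›, true_and, exists_isSystemOfOddParameters_iff_hasOddChain hn]

theorem isLUB_Ksdim (h : Ksdim₀ 𝒜 < ⊤) :
    IsLUB {d | ∃ n s, HasOddChain 𝒜 ⊤ n s ∧ d = toLex ((n : WithBot ℕ∞), (s : ℕ∞))}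
      (Ksdim 𝒜) := by
  obtain hA | hA := subsingleton_or_nontrivial A
  · rw [Ksdim_eq_bot]
    refine ⟨?_, fun _ _ => bot_le⟩
    rintro _ ⟨n, s, hns, -⟩
    have hn := hns.natCast_le_Ksdim₀.trans_eq (Ksdim₀_eq_bot_iff.mpr hA)
    exact absurd (le_bot_iff.mp hn) WithBot.coe_ne_bot
  obtain ⟨m, hm⟩ := exists_Ksdim₀_eq_natCast h
  rw [Ksdim, hm, Ksdim₁_eq_iSup_hasOddChain hm]
  refine ⟨?_, fun u hu => ?_⟩
  · rintro _ ⟨n, s, hns, rfl⟩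
    rw [Prod.Lex.toLex_le_toLex]
    refine (hns.natCast_le_Ksdim₀.trans_eq hm).lt_or_eq.imp_right fun hnm => ⟨hnm, ?_⟩
    obtain rfl : n = m := Nat.cast_injective (R := WithBot ℕ∞) hnm
    exact le_iSup₂_of_le s hns le_rfl
  · have hle (s : ℕ) (hs : HasOddChain 𝒜 ⊤ m s) := Prod.Lex.le_iff.mp (hu ⟨m, s, hs, rfl⟩)
    refine Prod.Lex.le_iff.mpr ((hle 0 ((hasOddChain_zero_iff m).mpr hm.ge)).imp_right fun h₀ =>
      ⟨h₀.1, iSup₂_le fun s hs => ?_⟩)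
    exact ((hle s hs).resolve_left h₀.1.not_lt).2

end SuperDimension

section BaseChange

open scoped Pointwise

variable {A : Type*} [Ring A] {𝒜 : ZMod 2 → AddSubgroup A} [SuperRing 𝒜]
  {R : Type*} [CommRing R] [Algebra (evenPart 𝒜) R]
  {B : Type*} [Ring B] [Algebra (evenPart 𝒜) B] [Algebra R B] [IsScalarTower (evenPart 𝒜) R B]
  {ℬ : ZMod 2 → AddSubgroup B} [SuperRing ℬ] {f : A →ₐ[evenPart 𝒜] B}

variable (R 𝒜 ℬ) in
/-- The super-ring `B` is, through `f`, the base change `R ⊗ A` of the super-ring `A` along an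
`A₀`-algebra `R`, with the grading extended from `A`. Completions and localizations are both of
this form. -/
structure IsGradedBaseChange (f : A →ₐ[evenPart 𝒜] B) : Prop where
  isBaseChange : IsBaseChange R f.toLinearMap
  map_mem {i : ZMod 2} {x : A} : x ∈ 𝒜 i → f x ∈ ℬ i
  algebraMap_mem (r : R) : algebraMap R B r ∈ ℬ 0

namespace IsGradedBaseChange

variable (hf : IsGradedBaseChange 𝒜 R ℬ f)
include hf

theorem proj_smul (i : ZMod 2) (r : R) (x : B) :
    GradedRing.proj ℬ i (r • x) = r • GradedRing.proj ℬ i x := by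
  have h := DirectSum.coe_decompose_mul_add_of_left_mem ℬ (j := i) (b := x) (hf.algebraMap_mem r)
  rw [zero_add] at h
  rw [Algebra.smul_def, Algebra.smul_def]
  exact h

theorem proj_map (i : ZMod 2) (x : A) : GradedRing.proj ℬ i (f x) = f (GradedRing.proj 𝒜 i x) :=
  let g : 𝒜 →+*ᵍ ℬ := ⟨f, hf.map_mem⟩
  g.map_directSumDecompose.symm

theorem mem_span_of_mem {i : ZMod 2} {y : B} (hy : y ∈ ℬ i) :
    y ∈ Submodule.span R (f '' 𝒜 i) := by
  suffices h : GradedRing.proj ℬ i y ∈ Submodule.span R (f '' 𝒜 i) by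
    rwa [GradedRing.proj_apply, DirectSum.decompose_of_mem_same ℬ hy] at h
  clear hy
  induction y using hf.isBaseChange.inductionOn with
  | zero => rw [map_zero]; exact zero_mem _
  | tmul x =>
    refine Submodule.subset_span ⟨GradedRing.proj 𝒜 i x, SetLike.coe_mem _, ?_⟩
    exact (hf.proj_map i x).symm
  | smul r x hx => rw [hf.proj_smul]; exact Submodule.smul_mem _ r hx
  | add x y hx hy => rw [map_add]; exact add_mem hx hy

theorem exists_algebraMap_eq_of_mem_even {y : B} (hy : y ∈ ℬ 0) :
    ∃ r : R, algebraMap R B r = y := by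
  suffices h : Submodule.span R (f '' 𝒜 0) ≤ LinearMap.range (Algebra.linearMap R B) from
    h (hf.mem_span_of_mem hy)
  rw [Submodule.span_le]
  rintro _ ⟨x, hx, rfl⟩
  exact ⟨algebraMap (evenPart 𝒜) R ⟨x, hx⟩,
    (IsScalarTower.algebraMap_apply _ R B _).symm.trans (f.commutes ⟨x, hx⟩).symm⟩

theorem hasPrimeChain_evenAnn_iff (y : B) (n : ℕ) :
    HasPrimeChain (evenAnn ℬ y) ⊤ n ↔ HasPrimeChain (Ideal.torsionOf R B y) ⊤ n := by
  let φ : R →+* evenPart ℬ := (algebraMap R B).codRestrict (evenPart ℬ) hf.algebraMap_mem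
  have hφ : Function.Surjective φ := fun z =>
    have ⟨r, hr⟩ := hf.exists_algebraMap_eq_of_mem_even z.2
    ⟨r, Subtype.ext hr⟩
  have hcomap : (evenAnn ℬ y).comap φ = Ideal.torsionOf R B y := by
    ext r
    rw [Ideal.mem_torsionOf_iff, Algebra.smul_def]
    rfl
  rw [← Ideal.map_comap_of_surjective φ hφ (evenAnn ℬ y), hasPrimeChain_map_iff
    (Ideal.map_comap_of_surjective φ hφ), hcomap, Ideal.comap_top]
  intro p hp _
  rw [range_comap_of_surjective _ φ hφ]
  exact (Ideal.comap_mono bot_le).trans hp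

theorem mem_span_image_pow {s : ℕ} {y : B} (hy : y ∈ (ℬ 1 : Set B) ^ s) :
    y ∈ Submodule.span R (f '' ((𝒜 1 : Set A) ^ s)) := by
  rw [Set.image_pow, ← Submodule.span_pow]
  exact Submodule.pow_subset_pow _ (Set.pow_subset_pow_left (fun _ => hf.mem_span_of_mem) hy)

theorem hasOddChain_iff [Module.Flat (evenPart 𝒜) R] (n s : ℕ) :
    HasOddChain ℬ ⊤ n s ↔ ∃ y ∈ (𝒜 1 : Set A) ^ s,
      HasPrimeChain ((evenAnn 𝒜 y).map (algebraMap (evenPart 𝒜) R)) ⊤ n := by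
  have htors (y : A) : Ideal.torsionOf R B (f y) = (evenAnn 𝒜 y).map (algebraMap _ R) :=
    torsionOf_eq_map_of_isBaseChange hf.isBaseChange y
  simp only [HasOddChain, hf.hasPrimeChain_evenAnn_iff, ← htors]
  constructor
  · rintro ⟨y, hy, h⟩
    obtain ⟨_, ⟨z, hz, rfl⟩, hzn⟩ := h.exists_of_mem_span (hf.mem_span_image_pow hy)
    exact ⟨z, hz, hzn⟩
  · rintro ⟨y, hy, h⟩
    refine ⟨f y, ?_, h⟩
    refine Set.pow_subset_pow_left (Set.image_subset_iff.mpr fun _ => hf.map_mem) ?_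
    rw [← Set.image_pow]
    exact ⟨y, hy, rfl⟩

end IsGradedBaseChange

end BaseChange

section Localization

variable {A : Type*} [Ring A] {𝒜 : ZMod 2 → AddSubgroup A} [SuperRing 𝒜]

variable (𝒜) in
/-- The homogeneous component `A_i` as an `A₀`-submodule of `A`. -/
def component (i : ZMod 2) : Submodule (evenPart 𝒜) A where
  __ := 𝒜 i
  smul_mem' r _ hx := localization_smul_mem 𝒜 ⊤ ⟨r, trivial⟩ hx

/-- The contraction `I₀ = I ∩ A₀` of a super-ideal `I`. -/
def evenIdeal (I : HomogeneousIdeal 𝒜) : Ideal (evenPart 𝒜) :=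
  I.toIdeal.comap (algebraMap (evenPart 𝒜) A)

theorem IsPrime.evenIdeal_isPrime {p : HomogeneousIdeal 𝒜} (hp : IsPrime p) :
    (evenIdeal p).IsPrime := by
  have : IsDomain (A ⧸ p.toIdeal) := hp
  have hker : evenIdeal p =
      RingHom.ker ((Ideal.Quotient.mk p.toIdeal).comp (algebraMap (evenPart 𝒜) A)) := by
    rw [← RingHom.comap_ker, Ideal.mk_ker, evenIdeal]
  rw [hker]
  exact RingHom.ker_isPrime _

/-- The algebra structure underlying the `Localization S`-module structure of `S⁻¹A`. -/
noncomputable instance (S : Submonoid (evenPart 𝒜)) :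
    Algebra (Localization S) (LocalizedModule S A) :=
  Algebra.ofModule
    (fun r x y => by
      induction r using Localization.induction_on
      induction x, y using LocalizedModule.induction_on₂
      simp only [LocalizedModule.mk_mul_mk, LocalizedModule.mk_smul_mk, smul_mul_assoc, mul_assoc])
    (fun r x y => by
      induction r using Localization.induction_on
      induction x, y using LocalizedModule.induction_on₂
      simp only [LocalizedModule.mk_mul_mk, LocalizedModule.mk_smul_mk, mul_smul_comm,
        mul_left_comm])

variable (𝒜) in
/-- The canonical map from a super-ring to its localization. -/
noncomputable def toLocalization (S : Submonoid (evenPart 𝒜)) :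
    A →ₐ[evenPart 𝒜] LocalizedModule S A where
  toRingHom := LocalizedModule.numeratorRingHom
  commutes' _ := rfl

theorem isGradedBaseChange_toLocalization (S : Submonoid (evenPart 𝒜)) :
    IsGradedBaseChange 𝒜 (Localization S) (localizationGrading 𝒜 S) (toLocalization 𝒜 S) where
  isBaseChange :=
    have : IsLocalizedModule S (toLocalization 𝒜 S).toLinearMap :=
      inferInstanceAs (IsLocalizedModule S (LocalizedModule.mkLinearMap S A))
    IsLocalizedModule.isBaseChange S (Localization S) _
  map_mem hx := ⟨_, hx, 1, rfl⟩
  algebraMap_mem r := by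
    induction r using Localization.induction_on with | H r
    rw [Algebra.algebraMap_eq_smul_one, OreLocalization.one_def]
    exact ⟨_, (component 𝒜 0).smul_mem r.1 (SetLike.one_mem_graded 𝒜), _,
      LocalizedModule.mk_smul_mk ..⟩

theorem hasOddChain_atPrimeGrading_iff {p : HomogeneousIdeal 𝒜} (hp : IsPrime p) (n s : ℕ) :
    HasOddChain (atPrimeGrading p hp) ⊤ n s ↔ HasOddChain 𝒜 (evenIdeal p) n s := by
  have := hp.evenIdeal_isPrime
  have hf : IsGradedBaseChange 𝒜 (Localization (primeCompl p hp)) (atPrimeGrading p hp)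
      (toLocalization 𝒜 (primeCompl p hp)) := isGradedBaseChange_toLocalization _
  have hloc : IsLocalization.AtPrime (Localization (primeCompl p hp)) (evenIdeal p) :=
    inferInstanceAs (IsLocalization (primeCompl p hp) _)
  have := IsLocalization.flat (Localization (primeCompl p hp)) (primeCompl p hp)
  rw [hf.hasOddChain_iff, HasOddChain]
  simp only [hasPrimeChain_map_algebraMap_atPrime_iff (evenIdeal p)]

end Localization

section Noetherian

variable {A : Type*} [Ring A] {𝒜 : ZMod 2 → AddSubgroup A} [SuperRing 𝒜]

theorem proj_mul_of_mem {i : ZMod 2} (a : A) {x : A} (hx : x ∈ 𝒜 i) :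
    GradedRing.proj 𝒜 i (a * x) = GradedRing.proj 𝒜 0 a * x := by
  have h := DirectSum.coe_decompose_mul_add_of_right_mem 𝒜 (i := 0) (a := a) hx
  rwa [zero_add] at h

theorem proj_mem_of_mem_span {i : ZMod 2} {N : Submodule (evenPart 𝒜) A}
    (hN : N ≤ component 𝒜 i) {x : A} (hx : x ∈ Ideal.span (N : Set A)) :
    GradedRing.proj 𝒜 i x ∈ N := by
  suffices h : ∀ a : A, GradedRing.proj 𝒜 i (a * x) ∈ N by simpa using h 1
  induction hx using Submodule.span_induction with
  | mem x hx =>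
    intro a
    rw [proj_mul_of_mem a (hN hx)]
    exact N.smul_mem ⟨_, SetLike.coe_mem _⟩ hx
  | zero => simp
  | add x y _ _ hx hy => intro a; rw [mul_add, map_add]; exact add_mem (hx a) (hy a)
  | smul b x _ hx => intro a; rw [smul_eq_mul, ← mul_assoc]; exact hx _

variable (𝒜) in
/-- The super-ideal generated by an `A₀`-submodule of the component `A_i`. -/
def spanSubcomponent (i : ZMod 2) (N : Set.Iic (component 𝒜 i)) : HomogeneousIdeal 𝒜 where
  toSubmodule := Ideal.span (N.1 : Set A)
  is_homogeneous' := Ideal.homogeneous_span 𝒜 _ fun _ hx => ⟨i, N.2 hx⟩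

theorem mem_spanSubcomponent_iff {i : ZMod 2} (N : Set.Iic (component 𝒜 i)) {x : A}
    (hx : x ∈ 𝒜 i) : x ∈ (spanSubcomponent 𝒜 i N).toIdeal ↔ x ∈ N.1 := by
  refine ⟨fun h => ?_, fun h => Ideal.subset_span h⟩
  have hproj := proj_mem_of_mem_span N.2 h
  rwa [GradedRing.proj_apply, DirectSum.decompose_of_mem_same 𝒜 hx] at hproj

theorem spanSubcomponent_strictMono (i : ZMod 2) : StrictMono (spanSubcomponent 𝒜 i) := by
  refine Monotone.strictMono_of_injective (fun N N' h => Ideal.span_mono h) fun N N' h => ?_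
  ext x
  refine ⟨fun hx => ?_, fun hx => ?_⟩
  · rwa [← mem_spanSubcomponent_iff N' (N.2 hx), ← h, mem_spanSubcomponent_iff N (N.2 hx)]
  · rwa [← mem_spanSubcomponent_iff N (N'.2 hx), h, mem_spanSubcomponent_iff N' (N'.2 hx)]

variable (hN : IsNoetherian 𝒜)
include hN

theorem IsNoetherian.component (i : ZMod 2) :
    _root_.IsNoetherian (evenPart 𝒜) (component 𝒜 i) :=
  have : WellFoundedGT (HomogeneousIdeal 𝒜) := hN
  have := (spanSubcomponent_strictMono (𝒜 := 𝒜) i).wellFoundedGT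
  isNoetherian_iff'.mpr (SuperRing.component 𝒜 i).mapIic.strictMono.wellFoundedGT

theorem IsNoetherian.evenPart : IsNoetherianRing (evenPart 𝒜) := by
  have := hN.component 0
  exact isNoetherian_of_injective
    ((Algebra.linearMap (SuperRing.evenPart 𝒜) A).codRestrict (SuperRing.component 𝒜 0)
      Subtype.property) (Set.injective_codRestrict _ |>.mpr Subtype.val_injective)

theorem IsNoetherian.finite : Module.Finite (SuperRing.evenPart 𝒜) A := by
  have := hN.component 0
  have := hN.component 1
  refine Module.Finite.of_surjective
    ((SuperRing.component 𝒜 0).subtype.coprod (SuperRing.component 𝒜 1).subtype) fun x => ?_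
  obtain ⟨a, ha, b, hb, rfl⟩ := exists_add 𝒜 x
  exact ⟨(⟨a, ha⟩, ⟨b, hb⟩), rfl⟩

end Noetherian

section AdicTopology

variable {A : Type*} [Ring A] {𝒜 : ZMod 2 → AddSubgroup A} [SuperRing 𝒜]

theorem mul_mem_even_of_mem_odd {s t : A} (hs : s ∈ 𝒜 1) (ht : t ∈ 𝒜 1) : s * t ∈ 𝒜 0 :=
  SetLike.mul_mem_graded (A := 𝒜) (i := 1) (j := 1) hs ht

theorem mul_mem_smul_top {K L : Ideal (evenPart 𝒜)} {x y : A}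
    (hx : x ∈ K • (⊤ : Submodule (evenPart 𝒜) A)) (hy : y ∈ L • (⊤ : Submodule (evenPart 𝒜) A)) :
    x * y ∈ (K * L) • (⊤ : Submodule (evenPart 𝒜) A) := by
  induction hx using Submodule.smul_induction_on' with
  | add x _ x' _ h h' => rw [add_mul]; exact add_mem h h'
  | smul r hr a _ =>
    induction hy using Submodule.smul_induction_on' with
    | add y _ y' _ h h' => rw [mul_add]; exact add_mem h h'
    | smul s hs b _ =>
      rw [smul_mul_assoc, mul_smul_comm, smul_smul]
      exact Submodule.smul_mem_smul (Ideal.mul_mem_mul hr hs) trivial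

theorem mul_mem_evenIdeal_smul_top {I : HomogeneousIdeal 𝒜} {x y : A} (hx : x ∈ I.toIdeal)
    (hy : y ∈ I.toIdeal) : x * y ∈ evenIdeal I • (⊤ : Submodule (evenPart 𝒜) A) := by
  have even_mul_mem {r : A} (hr : r ∈ 𝒜 0) (hrI : r ∈ I.toIdeal) (b : A) :
      r * b ∈ evenIdeal I • (⊤ : Submodule (evenPart 𝒜) A) :=
    Submodule.smul_mem_smul (r := (⟨r, hr⟩ : evenPart 𝒜)) hrI trivial
  have hx₀ : GradedRing.proj 𝒜 0 x ∈ 𝒜 0 := SetLike.coe_mem _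
  have hy₀ : GradedRing.proj 𝒜 0 y ∈ 𝒜 0 := SetLike.coe_mem _
  have hxy₁ : GradedRing.proj 𝒜 1 x * GradedRing.proj 𝒜 1 y ∈ 𝒜 0 :=
    mul_mem_even_of_mem_odd (SetLike.coe_mem _) (SetLike.coe_mem _)
  have expand : x * y = GradedRing.proj 𝒜 0 x * y + GradedRing.proj 𝒜 0 y * GradedRing.proj 𝒜 1 x
      + GradedRing.proj 𝒜 1 x * GradedRing.proj 𝒜 1 y * 1 := by
    rw [even_comm' 𝒜 hy₀, mul_one, add_assoc, ← mul_add, proj_add_proj, ← add_mul, proj_add_proj]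
  rw [expand]
  exact add_mem (add_mem (even_mul_mem hx₀ (I.isHomogeneous 0 hx) _)
    (even_mul_mem hy₀ (I.isHomogeneous 0 hy) _))
    (even_mul_mem hxy₁ (I.toIdeal.mul_mem_left _ (I.isHomogeneous 1 hy)) _)

variable (I : HomogeneousIdeal 𝒜)

theorem mem_evenIdeal_pow_smul_top_of_mem_pow (n : ℕ) {x : A} (hx : x ∈ I.toIdeal ^ (2 * n)) :
    x ∈ evenIdeal I ^ n • (⊤ : Submodule (evenPart 𝒜) A) := by
  induction n generalizing x with
  | zero => rw [pow_zero, Ideal.one_eq_top, Submodule.top_smul]; trivial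
  | succ n ih =>
    rw [mul_add, mul_one, Ideal.IsTwoSided.pow_add] at hx
    induction hx using Submodule.mul_induction_on' with
    | add x _ y _ h h' => exact add_mem h h'
    | mem_mul_mem a ha b hb =>
      rw [pow_succ]
      refine mul_mem_smul_top (ih ha) ?_
      rw [Ideal.IsTwoSided.pow_succ (n := 1), Submodule.pow_one] at hb
      induction hb using Submodule.mul_induction_on' with
      | add x _ y _ h h' => exact add_mem h h'
      | mem_mul_mem x hx y hy => exact mul_mem_evenIdeal_smul_top hx hy

theorem coe_mem_pow_of_mem_evenIdeal_pow (n : ℕ) {r : evenPart 𝒜} (hr : r ∈ evenIdeal I ^ n) :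
    (r : A) ∈ I.toIdeal ^ n := by
  induction n generalizing r with
  | zero => rw [Submodule.pow_zero, Ideal.one_eq_top]; trivial
  | succ n ih =>
    rw [pow_succ'] at hr
    rw [Ideal.IsTwoSided.pow_succ]
    induction hr using Submodule.mul_induction_on' with
    | add x _ y _ h h' => exact add_mem h h'
    | mem_mul_mem a ha b hb => exact Ideal.mul_mem_mul ha (ih hb)

theorem mem_pow_of_mem_evenIdeal_pow_smul_top (n : ℕ) {x : A}
    (hx : x ∈ evenIdeal I ^ n • (⊤ : Submodule (evenPart 𝒜) A)) : x ∈ I.toIdeal ^ n := by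
  induction hx using Submodule.smul_induction_on' with
  | add x _ y _ h h' => exact add_mem h h'
  | smul r hr a _ =>
    rw [Algebra.smul_def]
    exact Ideal.mul_mem_right _ _ (coe_mem_pow_of_mem_evenIdeal_pow I n hr)

end AdicTopology

section CompletionComparison

universe u

variable {A : Type u} [Ring A] {𝒜 : ZMod 2 → AddSubgroup A} [SuperRing 𝒜]
variable (I : HomogeneousIdeal 𝒜)

/-- The comparison map from the completion of the `A₀`-module `A` at the contraction of `I`; it is
an isomorphism. -/
def ofModuleCompletion : AdicCompletion (evenIdeal I) A →+ completion I where
  toFun x := ⟨fun n => QuotientAddGroup.map _ (I.toIdeal ^ n).toAddSubgroup (AddMonoidHom.id A)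
      (fun _ h => mem_pow_of_mem_evenIdeal_pow_smul_top I n h) (x.val n), by
    obtain ⟨x, rfl⟩ := AdicCompletion.mk_surjective _ _ x
    intro m n h
    change Ideal.Quotient.mk (I.toIdeal ^ m) (x.val n) = Ideal.Quotient.mk (I.toIdeal ^ m) (x.val m)
    rw [Ideal.Quotient.eq]
    exact mem_pow_of_mem_evenIdeal_pow_smul_top I m (SModEq.sub_mem.mp (x.property h).symm)⟩
  map_zero' := rfl
  map_add' _ _ := Subtype.ext (funext fun _ => map_add _ _ _)

theorem ofModuleCompletion_injective : Function.Injective (ofModuleCompletion I) := by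
  rw [injective_iff_map_eq_zero]
  intro x hx
  obtain ⟨x, rfl⟩ := AdicCompletion.mk_surjective _ _ x
  refine AdicCompletion.mk_zero_of _ _ _ ⟨0, fun n _ => ⟨2 * n, by omega, n, le_rfl, ?_⟩⟩
  apply mem_evenIdeal_pow_smul_top_of_mem_pow
  rw [← Ideal.Quotient.eq_zero_iff_mem]
  exact congrFun (congrArg Subtype.val hx) (2 * n)

theorem ofModuleCompletion_surjective : Function.Surjective (ofModuleCompletion I) := by
  intro y
  choose a ha using fun n => Ideal.Quotient.mk_surjective (y.1 n)
  have hcauchy (m n : ℕ) (h : m ≤ n) : a m - a n ∈ I.toIdeal ^ m := by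
    rw [← Ideal.Quotient.eq, ha, ← y.2 m n h, ← ha n]
    rfl
  let b := AdicCompletion.AdicCauchySequence.mk (evenIdeal I) A (fun n => a (2 * n)) fun n =>
    SModEq.sub_mem.mpr (mem_evenIdeal_pow_smul_top_of_mem_pow I n (hcauchy _ _ (by omega)))
  refine ⟨AdicCompletion.mk _ _ b, Subtype.ext (funext fun n => ?_)⟩
  rw [← ha]
  exact (Ideal.Quotient.eq.mpr (hcauchy n (2 * n) (by omega))).symm

/-- The comparison map from the completion of `A₀` at the contraction of `I`. -/
noncomputable def ofEvenCompletion :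
    AdicCompletion (evenIdeal I) (evenPart 𝒜) →+* completion I where
  toFun x := ofModuleCompletion I
    (AdicCompletion.map (evenIdeal I) (Algebra.linearMap (evenPart 𝒜) A) x)
  map_zero' := by rw [map_zero, map_zero]
  map_add' x y := by rw [map_add, map_add]
  map_one' := rfl
  map_mul' x y := by
    obtain ⟨x, rfl⟩ := AdicCompletion.mk_surjective _ _ x
    obtain ⟨y, rfl⟩ := AdicCompletion.mk_surjective _ _ y
    rfl

theorem ofEvenCompletion_mem (t : AdicCompletion (evenIdeal I) (evenPart 𝒜)) :
    ofEvenCompletion I t ∈ completionGrading I 0 := by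
  obtain ⟨t, rfl⟩ := AdicCompletion.mk_surjective _ _ t
  exact fun n => ⟨t.val n, (t.val n).2, rfl⟩

noncomputable instance :
    Algebra (AdicCompletion (evenIdeal I) (evenPart 𝒜)) (completion I) :=
  (ofEvenCompletion I).toAlgebra' fun t x =>
    even_comm' (completionGrading I) (ofEvenCompletion_mem I t) x

noncomputable instance : Algebra (evenPart 𝒜) (completion I) :=
  Algebra.compHom _ (algebraMap (evenPart 𝒜) (AdicCompletion (evenIdeal I) (evenPart 𝒜)))

instance : IsScalarTower (evenPart 𝒜) (AdicCompletion (evenIdeal I) (evenPart 𝒜)) (completion I) :=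
  .of_algebraMap_eq' rfl

/-- The canonical map from a super-ring to its completion. -/
def toCompletion : A →ₐ[evenPart 𝒜] completion I where
  toFun a := ⟨fun _ => Ideal.Quotient.mk _ a, fun _ _ _ => rfl⟩
  map_zero' := rfl
  map_one' := rfl
  map_add' _ _ := rfl
  map_mul' _ _ := rfl
  commutes' _ := rfl

/-- `ofModuleCompletion` as an isomorphism over the completion of `A₀`. -/
noncomputable def moduleCompletionEquiv : AdicCompletion (evenIdeal I) A
    ≃ₗ[AdicCompletion (evenIdeal I) (evenPart 𝒜)] completion I :=
  .ofBijective
    { ofModuleCompletion I with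
      map_smul' := fun t x => by
        obtain ⟨t, rfl⟩ := AdicCompletion.mk_surjective _ _ t
        obtain ⟨x, rfl⟩ := AdicCompletion.mk_surjective _ _ x
        rfl }
    ⟨ofModuleCompletion_injective I, ofModuleCompletion_surjective I⟩

theorem isGradedBaseChange_toCompletion (hN : IsNoetherian 𝒜) :
    IsGradedBaseChange 𝒜 (AdicCompletion (evenIdeal I) (evenPart 𝒜)) (completionGrading I)
      (toCompletion I) where
  isBaseChange := by
    have := hN.evenPart
    have := hN.finite
    refine IsBaseChange.of_equiv
      ((AdicCompletion.ofTensorProductEquivOfFiniteNoetherian (evenIdeal I) A).trans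
        (moduleCompletionEquiv I)) fun x => ?_
    rw [LinearEquiv.trans_apply, AdicCompletion.ofTensorProductEquivOfFiniteNoetherian_apply,
      AdicCompletion.ofTensorProduct_tmul, one_smul]
    rfl
  map_mem hx _ := ⟨_, hx, rfl⟩
  algebraMap_mem := ofEvenCompletion_mem I

theorem hasOddChain_completionGrading_iff (hN : IsNoetherian 𝒜) (n s : ℕ) :
    HasOddChain (completionGrading I) ⊤ n s ↔ ∃ q : PrimeSpectrum (evenPart 𝒜),
      evenIdeal I ≤ q.asIdeal ∧ HasOddChain 𝒜 q.asIdeal n s := by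
  have := hN.evenPart
  have := AdicCompletion.flat_of_isNoetherian (evenIdeal I)
  rw [(isGradedBaseChange_toCompletion I hN).hasOddChain_iff]
  simp only [hasPrimeChain_map_adicCompletion_iff, HasOddChain]
  tauto

end CompletionComparison

section PrimeSuperIdeals

variable {A : Type*} [Ring A] {𝒜 : ZMod 2 → AddSubgroup A} [SuperRing 𝒜]

theorem mul_mem_of_mem_odd (q : Ideal (evenPart 𝒜)) [hq : q.IsPrime] {s t : A} (hs : s ∈ 𝒜 1)
    (ht : t ∈ 𝒜 1) : (⟨s * t, mul_mem_even_of_mem_odd hs ht⟩ : evenPart 𝒜) ∈ q := by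
  refine hq.mem_of_pow_mem 2 ?_
  convert q.zero_mem
  refine Subtype.ext ?_
  calc (s * t) ^ 2 = s * (t * s) * t := by rw [pow_two]; simp only [mul_assoc]
    _ = -(s * s * (t * t)) := by rw [odd_anticomm 𝒜 ht hs]; noncomm_ring
    _ = 0 := by rw [odd_sq (𝒜 := 𝒜) s hs, zero_mul, neg_zero]

theorem proj_zero_mul (x y : A) : GradedRing.proj 𝒜 0 (x * y) =
    GradedRing.proj 𝒜 0 x * GradedRing.proj 𝒜 0 y +
      GradedRing.proj 𝒜 1 x * GradedRing.proj 𝒜 1 y := by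
  have h₀ : GradedRing.proj 𝒜 0 (x * GradedRing.proj 𝒜 0 y) =
      GradedRing.proj 𝒜 0 x * GradedRing.proj 𝒜 0 y :=
    DirectSum.coe_decompose_mul_add_of_right_mem 𝒜 (i := 0) (j := 0) (SetLike.coe_mem _)
  have h₁ : GradedRing.proj 𝒜 0 (x * GradedRing.proj 𝒜 1 y) =
      GradedRing.proj 𝒜 1 x * GradedRing.proj 𝒜 1 y :=
    DirectSum.coe_decompose_mul_add_of_right_mem 𝒜 (i := 1) (j := 1) (SetLike.coe_mem _)
  rw [← h₀, ← h₁, ← map_add, ← mul_add, proj_add_proj]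

variable (𝒜) in
/-- The projection `A → A₀`, as a map of `A₀`-modules. -/
noncomputable def evenProj : A →ₗ[evenPart 𝒜] evenPart 𝒜 where
  toFun x := ⟨GradedRing.proj 𝒜 0 x, SetLike.coe_mem _⟩
  map_add' x y := Subtype.ext (map_add _ x y)
  map_smul' r x := Subtype.ext <| by
    have h := DirectSum.coe_decompose_mul_add_of_left_mem 𝒜 (j := 0) (b := x) r.2
    rwa [zero_add] at h

theorem evenProj_coe (r : evenPart 𝒜) : evenProj 𝒜 r = r :=
  Subtype.ext (DirectSum.decompose_of_mem_same 𝒜 r.2)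

/-- The ring homomorphism `A → A₀ ⧸ q` that kills the odd part and the prime ideal `q` of `A₀`. -/
noncomputable def evenResidue (q : Ideal (evenPart 𝒜)) [q.IsPrime] : A →+* evenPart 𝒜 ⧸ q where
  toFun x := Ideal.Quotient.mk q (evenProj 𝒜 x)
  map_zero' := by rw [map_zero, map_zero]
  map_one' := by rw [← OneMemClass.coe_one (evenPart 𝒜), evenProj_coe, map_one]
  map_add' x y := by rw [map_add, map_add]
  map_mul' x y := by
    rw [← map_mul, Ideal.Quotient.eq]
    convert mul_mem_of_mem_odd q (SetLike.coe_mem (DirectSum.decompose 𝒜 x 1))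
      (SetLike.coe_mem (DirectSum.decompose 𝒜 y 1))
    exact Subtype.ext (sub_eq_of_eq_add' (proj_zero_mul x y))

theorem evenResidue_eq_zero_iff {q : Ideal (evenPart 𝒜)} [q.IsPrime] {x : A} :
    evenResidue q x = 0 ↔ evenProj 𝒜 x ∈ q :=
  Ideal.Quotient.eq_zero_iff_mem

theorem evenResidue_eq_zero_of_mem_odd (q : Ideal (evenPart 𝒜)) [q.IsPrime] {x : A}
    (hx : x ∈ 𝒜 1) : evenResidue q x = 0 := by
  rw [evenResidue_eq_zero_iff]
  convert q.zero_mem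
  exact Subtype.ext (DirectSum.decompose_of_mem_ne 𝒜 hx (by decide))

/-- The prime super-ideal `q ⊕ A₁` attached to a prime ideal `q` of `A₀`. -/
noncomputable def primeOfEven (q : Ideal (evenPart 𝒜)) [q.IsPrime] : HomogeneousIdeal 𝒜 where
  toSubmodule := RingHom.ker (evenResidue q)
  is_homogeneous' i x hx := by
    have hx₁ : evenResidue q (GradedRing.proj 𝒜 1 x) = 0 :=
      evenResidue_eq_zero_of_mem_odd q (SetLike.coe_mem _)
    have hx₀ : evenResidue q (GradedRing.proj 𝒜 0 x) = 0 := by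
      rw [← proj_add_proj 𝒜 x, RingHom.mem_ker, map_add, hx₁, add_zero] at hx
      exact hx
    fin_cases i
    · exact hx₀
    · exact hx₁

theorem evenIdeal_primeOfEven (q : Ideal (evenPart 𝒜)) [q.IsPrime] :
    evenIdeal (primeOfEven q) = q := by
  ext r
  change evenResidue q r = 0 ↔ _
  rw [evenResidue_eq_zero_iff, evenProj_coe]

theorem isPrime_primeOfEven (q : Ideal (evenPart 𝒜)) [q.IsPrime] : IsPrime (primeOfEven q) :=
  (RingHom.kerLift_injective (evenResidue q)).isDomain (RingHom.kerLift (evenResidue q))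

theorem le_primeOfEven {I : HomogeneousIdeal 𝒜} {q : Ideal (evenPart 𝒜)} [q.IsPrime]
    (h : evenIdeal I ≤ q) : I ≤ primeOfEven q :=
  fun _ hx => evenResidue_eq_zero_iff.mpr (h (I.isHomogeneous 0 hx))

end PrimeSuperIdeals

section CompletionDimension

universe u

variable {A : Type u} [Ring A] {𝒜 : ZMod 2 → AddSubgroup A} [SuperRing 𝒜]

theorem hasOddChain_completionGrading_iff_exists_atPrime (hN : IsNoetherian 𝒜)
    (I : HomogeneousIdeal 𝒜) (n s : ℕ) :
    HasOddChain (completionGrading I) ⊤ n s ↔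
      ∃ (p : HomogeneousIdeal 𝒜) (hp : IsPrime p),
        I ≤ p ∧ HasOddChain (atPrimeGrading p hp) ⊤ n s := by
  simp only [hasOddChain_completionGrading_iff I hN, hasOddChain_atPrimeGrading_iff]
  constructor
  · rintro ⟨q, hIq, h⟩
    refine ⟨primeOfEven q.asIdeal, isPrime_primeOfEven _, le_primeOfEven hIq, ?_⟩
    rwa [evenIdeal_primeOfEven]
  · rintro ⟨p, hp, hIp, h⟩
    exact ⟨⟨evenIdeal p, hp.evenIdeal_isPrime⟩, Ideal.comap_mono hIp, h⟩

theorem Ksdim₀_atPrimeGrading_le_completionGrading (hN : IsNoetherian 𝒜)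
    {I p : HomogeneousIdeal 𝒜} (hp : IsPrime p) (hIp : I ≤ p) :
    Ksdim₀ (atPrimeGrading p hp) ≤ Ksdim₀ (completionGrading I) :=
  Ksdim₀_le_of_forall_hasOddChain fun n h =>
    ((hasOddChain_completionGrading_iff_exists_atPrime hN I n 0).mpr
      ⟨p, hp, hIp, h⟩).natCast_le_Ksdim₀

theorem Ksdim₀_completionGrading_le (hN : IsNoetherian 𝒜) (I : HomogeneousIdeal 𝒜) :
    Ksdim₀ (completionGrading I) ≤ Ksdim₀ 𝒜 := by
  refine Ksdim₀_le_of_forall_hasOddChain fun n hn => ?_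
  obtain ⟨q, -, y, hy, h⟩ := (hasOddChain_completionGrading_iff I hN n 0).mp hn
  exact HasOddChain.natCast_le_Ksdim₀ ⟨y, hy, h.mono le_rfl le_top⟩

end CompletionDimension

end SuperRing

open SuperRing in
theorem mainTheorem4_general {A : Type*} [Ring A] {𝒜 : ZMod 2 → AddSubgroup A} [SuperRing 𝒜]
    (hN : SuperRing.IsNoetherian 𝒜) (I : HomogeneousIdeal 𝒜)
    (hfin : Ksdim₀ (completionGrading I) < ⊤) :
    IsLUB {d | ∃ (p : HomogeneousIdeal 𝒜) (hp : SuperRing.IsPrime p),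
        I ≤ p ∧ d = Ksdim (atPrimeGrading p hp)} (Ksdim (completionGrading I)) := by
  have hchain := hasOddChain_completionGrading_iff_exists_atPrime hN I
  have hloc (p : HomogeneousIdeal 𝒜) (hp : SuperRing.IsPrime p) (hIp : I ≤ p) :=
    isLUB_Ksdim ((Ksdim₀_atPrimeGrading_le_completionGrading hN hp hIp).trans_lt hfin)
  obtain ⟨hupper, hleast⟩ := isLUB_Ksdim hfin
  refine ⟨?_, fun u hu => hleast ?_⟩
  · rintro _ ⟨p, hp, hIp, rfl⟩
    refine (hloc p hp hIp).2 ?_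
    rintro _ ⟨n, s, h, rfl⟩
    exact hupper ⟨n, s, (hchain n s).mpr ⟨p, hp, hIp, h⟩, rfl⟩
  · rintro _ ⟨n, s, h, rfl⟩
    obtain ⟨p, hp, hIp, h⟩ := (hchain n s).mp h
    exact ((hloc p hp hIp).1 ⟨n, s, h, rfl⟩).trans (hu ⟨p, hp, hIp, rfl⟩)

theorem mainTheorem4 {A : Type*} [Ring A] (𝒜 : ZMod 2 → AddSubgroup A) [SuperRing 𝒜]
    (hN : SuperRing.IsNoetherian 𝒜) (hfin : SuperRing.Ksdim₀ 𝒜 < ⊤)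
    (I : HomogeneousIdeal 𝒜) :
    IsLUB {d | ∃ (p : HomogeneousIdeal 𝒜) (hp : SuperRing.IsPrime p),
        I ≤ p ∧ d = SuperRing.Ksdim (SuperRing.atPrimeGrading p hp)}
      (SuperRing.Ksdim (SuperRing.completionGrading I)) :=
  mainTheorem4_general hN I ((SuperRing.Ksdim₀_completionGrading_le hN I).trans_lt hfin)
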